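/- Let $\mathcal{C}_n=\{0,1\}^n$ be the Boolean cube with componentwise addition modulo $2$ and the Hamming distance $d$. The weight of a word is its number of non-zero coordinates; $E$ and $O$ denote the sets of words of even and of odd weight, and $T_{a}(c)=c+a$. For $P\subseteq\{1,\dots,n\}$, a $P$-isometry of $\mathcal{C}_n$ is a bijection $\phi:\mathcal{C}_n\to\mathcal{C}_n$ such that, for all $p\in P$ and all words $x,y$, $d(x,y)=p$ implies $d(\phi(x),\phi(y))=p$. A $p$-isometry is a $\{p\}$-isometry, an isometry is a bijection preserving all distances, and an even isometry is a $P$-isometry with $P$ the set of all even numbers in $\{1,\dots,n\}$. Given $i,j\in\{1,\dots,n\}$ (possibly equal) and a bijection $\sigma:\{1,\dots,n\}\setminus\{i\}\to\{1,\dots,n\}\setminus\{j\}$, the corresponding $\sigma_{i,j}$-mapping on $\mathcal{C}_n$ sends $c=(c_1,\dots,c_n)$ to $d=(d_1,\dots,d_n)$, where $d_k=c_{\sigma^{-1}(k)}$ for $k\ne j$ and $d_j=0$ if $c_i=0$, and $d_k=c_{\sigma^{-1}(k)}+1$ for $k\neq j$ and $d_j=1$ if $c_i=1$. (1) Let $n\equiv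 1\pmod 4$. If $\phi$ is an $\frac{n+1}{2}$-isometry of $\mathcal{C}_n$ with $\phi(\overline{0})=\overline{0}$ that is not an isometry, then $\phi$ is a $\sigma_{i,j}$-mapping on $\mathcal{C}_n$ for some $i$, $j$ and $\sigma$. Conversely, every $\sigma_{i,j}$-mapping on $\mathcal{C}_n$ is an $\frac{n+1}{2}$-isometry. (2) Let $n\equiv 3\pmod 4$. If $\phi$ is an $\frac{n+1}{2}$-isometry of $\mathcal{C}_n$ with $\phi(\overline{0})=\overline{0}$ that is not an even isometry, then at least one of the following holds: I) there are a $\sigma_{i,j}$-mapping $\tau$ on $\mathcal{C}_n$ and a word $a$ of even weight such that $\phi$ coincides on $E$ with some even isometry of $\mathcal{C}_n$, and $\phi=T_{a}\circ\tau$ on $O$; II) there is a $\sigma_{i,j}$-mapping $\tau$ on $\mathcal{C}_n$ such that $\phi=\tau$ on $E$, and $\phi$ coincides on $O$ with some even isometry of $\mathcal{C}_n$; III) there are a $\sigma_{i,j}$-mapping $\tau_1$ and a $\sigma_{k,l}$-mapping $\tau_2$ on $\mathcal{C}_n$ and a word $a$ of even weight such that $\phi=\tau_1$ on $E$ and $\phi=T_{a}\circ\tau_2$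 on $O$. -/

import Mathlib

/-- The Boolean cube `C_n`: words of length `n` over `ℤ/2`, with componentwise addition.
Its metric is Mathlib's `hammingDist`, and the weight of a word is `hammingNorm`. -/
abbrev BoolCube (n : ℕ) : Type := Fin n → ZMod 2

/-- A `P`-isometry: a bijection of `C_n` preserving every Hamming distance in `P`. -/
def IsWeakIsometry {n : ℕ} (P : Set ℕ) (φ : BoolCube n → BoolCube n) : Prop :=
  Function.Bijective φ ∧
    ∀ p ∈ P, ∀ x y : BoolCube n, hammingDist x y = p → hammingDist (φ x) (φ y) = p

/-- An isometry: a bijection of `C_n` preserving all Hamming distances. -/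
def IsCubeIsometry {n : ℕ} (φ : BoolCube n → BoolCube n) : Prop :=
  Function.Bijective φ ∧ ∀ x y : BoolCube n, hammingDist (φ x) (φ y) = hammingDist x y

/-- An even isometry: a `P`-isometry for `P` the set of all even numbers in `{1, …, n}`. -/
def IsEvenIsometry {n : ℕ} (φ : BoolCube n → BoolCube n) : Prop :=
  IsWeakIsometry {p : ℕ | p ∈ Set.Icc 1 n ∧ Even p} φ

/-- The set `E` of words of even weight. -/
def evenWords (n : ℕ) : Set (BoolCube n) := {c | Even (hammingNorm c)}

/-- The set `O` of words of odd weight. -/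
def oddWords (n : ℕ) : Set (BoolCube n) := {c | Odd (hammingNorm c)}

/-- The translation `T_a : c ↦ c + a`. -/
def cubeTranslation {n : ℕ} (a : BoolCube n) : BoolCube n → BoolCube n := fun c => c + a

/-- `φ` is the `σ_{i,j}`-mapping on `C_n` attached to the positions `i`, `j` and to the bijection
`σ` from the positions other than `i` to the positions other than `j`. -/
def IsSigmaMappingOf {n : ℕ} (i j : Fin n) (σ : {k : Fin n // k ≠ i} ≃ {k : Fin n // k ≠ j})
    (φ : BoolCube n → BoolCube n) : Prop :=
  ∀ c : BoolCube n,
    (c i = 0 → (∀ k : {k : Fin n // k ≠ j}, φ c k = c (σ.symm k)) ∧ φ c j = 0) ∧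
    (c i = 1 → (∀ k : {k : Fin n // k ≠ j}, φ c k = c (σ.symm k) + 1) ∧ φ c j = 1)

/-- `φ` is a `σ_{i,j}`-mapping on `C_n` for some `i`, `j` (possibly equal) and some `σ`. -/
def IsSigmaMapping {n : ℕ} (φ : BoolCube n → BoolCube n) : Prop :=
  ∃ (i j : Fin n) (σ : {k : Fin n // k ≠ i} ≃ {k : Fin n // k ≠ j}), IsSigmaMappingOf i j σ φ

/-- `φ` acts on the words of `A` as some even isometry of `C_n` does. -/
def ActsAsEvenIsometryOn {n : ℕ} (φ : BoolCube n → BoolCube n) (A : Set (BoolCube n)) : Prop :=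
  ∃ ψ : BoolCube n → BoolCube n, IsEvenIsometry ψ ∧ Set.EqOn φ ψ A

/-!
Adding an extra coordinate identifies `C_n` with the cube `C_{n+1}` modulo antipodes, so that words
become sets of `n + 1` coordinates up to complement and every permutation of the `n + 1` coordinates
acts on `C_n`. For `n + 1 = 2p`, complementing preserves the size `p`, so these maps are
`p`-isometries; those fixing the extra coordinate are isometries, and the others are precisely the
`σ_{i,j}`-mappings.

Conversely, two words at even distance `2i` have `C(2i, i) C(2(p - i), p - i) / 2` common
`p`-neighbours, and words at odd distance have none. As this number is strictly decreasing for
`i ≤ p / 2`, a `p`-isometry preserves even distances up to `2i ↔ n + 1 - 2i`. Around each word it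
therefore permutes the words represented by two-element sets, and by Whitney's theorem on the line
graph of a complete graph it does so as some permutation of the `n + 1` coordinates. This
permutation does not depend on the base point within the even words, nor within the odd ones. If `p`
is odd, all `p`-neighbours of an odd word are even, so the values on the even words determine the
others.
-/

open Function
open scoped Finset symmDiff

section Counting

theorem card_symmDiff_add_two_mul_card_inter {α : Type*} [DecidableEq α] (s t : Finset α) :
    #(s ∆ t) + 2 * #(s ∩ t) = #s + #t := by
  have hs := Finset.card_sdiff_add_card_inter s t
  have ht := Finset.card_sdiff_add_card_inter t s
  rw [Finset.inter_comm t s] at ht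
  have hst : #(s ∆ t) = #(s \ t) + #(t \ s) :=
    Finset.card_union_of_disjoint disjoint_sdiff_sdiff
  lia

theorem card_filter_card_symmDiff {α : Type*} [Fintype α] [DecidableEq α] {s : Finset α}
    {p i : ℕ} (hs : #s = 2 * i) (hip : i ≤ p) :
    #{t : Finset α | #t = p ∧ #(s ∆ t) = p} =
      (2 * i).choose i * (Fintype.card α - 2 * i).choose (p - i) := by
  have hcard (t : Finset α) :
      (#t = p ∧ #(s ∆ t) = p) ↔ #(s ∩ t) = i ∧ #(t \ s) = p - i := by
    have h₁ := card_symmDiff_add_two_mul_card_inter s t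
    have h₂ := Finset.card_sdiff_add_card_inter t s
    rw [Finset.inter_comm] at h₂
    lia
  have hparts {t : Finset α × Finset α}
      (ht : t ∈ (s.powersetCard i ×ˢ sᶜ.powersetCard (p - i) : Finset _)) :
      s ∩ (t.1 ∪ t.2) = t.1 ∧ (t.1 ∪ t.2) \ s = t.2 ∧ #t.1 = i ∧ #t.2 = p - i := by
    simp only [Finset.mem_product, Finset.mem_powersetCard] at ht
    obtain ⟨⟨hs₁, h₁⟩, hs₂, h₂⟩ := ht
    rw [Finset.subset_compl_iff_disjoint_left] at hs₂
    rw [Finset.inter_union_distrib_left, Finset.inter_eq_right.mpr hs₁,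
      Finset.disjoint_iff_inter_eq_empty.mp hs₂, Finset.union_empty, Finset.union_sdiff_distrib,
      Finset.sdiff_eq_empty_iff_subset.mpr hs₁, Finset.empty_union,
      Finset.sdiff_eq_self_of_disjoint hs₂.symm]
    exact ⟨rfl, rfl, h₁, h₂⟩
  calc #{t : Finset α | #t = p ∧ #(s ∆ t) = p}
      = #(s.powersetCard i ×ˢ sᶜ.powersetCard (p - i)) := by
        refine Finset.card_nbij' (fun t => (s ∩ t, t \ s)) (fun t => t.1 ∪ t.2) ?_ ?_ ?_ ?_
        · intro t ht
          rw [Finset.mem_coe, Finset.mem_filter_univ, hcard] at ht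
          simp [Finset.subset_compl_iff_disjoint_right, Finset.sdiff_disjoint, ht]
        · intro t ht
          obtain ⟨hinter, hsdiff, h⟩ := hparts ht
          rwa [Finset.mem_coe, Finset.mem_filter_univ, hcard, hinter, hsdiff]
        · intro t _
          change s ∩ t ∪ t \ s = t
          rw [Finset.inter_comm, Finset.union_comm, Finset.sdiff_union_inter]
        · exact fun t ht => Prod.ext (hparts ht).1 (hparts ht).2.1
    _ = (2 * i).choose i * (Fintype.card α - 2 * i).choose (p - i) := by
        rw [Finset.card_product, Finset.card_powersetCard, Finset.card_powersetCard,
          Finset.card_compl, hs]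

theorem two_mul_choose_two_mul_sub_one {m : ℕ} (hm : m ≠ 0) :
    2 * (2 * m - 1).choose m = m.centralBinom := by
  obtain ⟨k, rfl⟩ := Nat.exists_eq_succ_of_ne_zero hm
  rw [Nat.centralBinom_eq_two_mul_choose, Nat.succ_eq_add_one,
    show 2 * (k + 1) = 2 * k + 1 + 1 by ring, Nat.choose_succ_succ', Nat.add_sub_cancel,
    Nat.choose_symm_half]
  ring

theorem centralBinom_succ_mul_lt {a b : ℕ} (h : a < b) :
    (a + 1).centralBinom * b.centralBinom < a.centralBinom * (b + 1).centralBinom := by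
  have ha := Nat.succ_mul_centralBinom_succ a
  have hb := Nat.succ_mul_centralBinom_succ b
  have hpos : 0 < a.centralBinom * b.centralBinom :=
    Nat.mul_pos a.centralBinom_pos b.centralBinom_pos
  refine lt_of_mul_lt_mul_left (a := (a + 1) * (b + 1)) ?_ (Nat.zero_le _)
  calc (a + 1) * (b + 1) * ((a + 1).centralBinom * b.centralBinom)
      = 2 * ((b + 1) * (2 * a + 1)) * (a.centralBinom * b.centralBinom) := by
        linear_combination (b + 1) * b.centralBinom * ha
    _ < 2 * ((a + 1) * (2 * b + 1)) * (a.centralBinom * b.centralBinom) := by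
        gcongr 2 * ?_ * _
        linarith
    _ = (a + 1) * (b + 1) * (a.centralBinom * (b + 1).centralBinom) := by
        linear_combination -((a + 1) * a.centralBinom * hb)

theorem strictAntiOn_centralBinom_mul (p : ℕ) :
    StrictAntiOn (fun i => i.centralBinom * (p - i).centralBinom) (Set.Iic (p / 2)) := by
  refine strictAntiOn_of_succ_lt Set.ordConnected_Iic fun i _ _ hi => ?_
  rw [Nat.succ_eq_succ, Nat.succ_eq_add_one, Set.mem_Iic] at hi
  have h := centralBinom_succ_mul_lt (a := i) (b := p - (i + 1)) (by lia)
  rwa [show p - (i + 1) + 1 = p - i by lia] at h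

end Counting

section Words

variable {ι : Type*} [Fintype ι]

theorem hammingDist_eq_hammingNorm_add (x y : ι → ZMod 2) :
    hammingDist x y = hammingNorm (x + y) := by
  rw [hammingDist_eq_hammingNorm, ZModModule.neg_eq_self]

theorem hammingDist_add_right (x y a : ι → ZMod 2) :
    hammingDist (x + a) (y + a) = hammingDist x y :=
  hammingDist_comp (fun k t => t + a k) fun k => add_left_injective (a k)

theorem natCast_hammingNorm (x : ι → ZMod 2) : (hammingNorm x : ZMod 2) = ∑ k, x k := by
  have h (a : ZMod 2) : (if a ≠ 0 then 1 else 0) = a := by decide +revert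
  simp only [hammingNorm, Finset.natCast_card_filter, h]

theorem even_hammingNorm_add (x y : ι → ZMod 2) :
    Even (hammingNorm (x + y)) ↔ (Even (hammingNorm x) ↔ Even (hammingNorm y)) := by
  rw [← Nat.even_add]
  simp only [← ZMod.natCast_eq_zero_iff_even, Nat.cast_add, natCast_hammingNorm, Pi.add_apply,
    Finset.sum_add_distrib]

theorem even_hammingDist (x y : ι → ZMod 2) :
    Even (hammingDist x y) ↔ (Even (hammingNorm x) ↔ Even (hammingNorm y)) := by
  rw [hammingDist_eq_hammingNorm_add, even_hammingNorm_add]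

end Words

section IndicatorWord

variable {ι : Type*} [DecidableEq ι]

/-- The word with support `s`. -/
def indicatorWord (s : Finset ι) : ι → ZMod 2 := fun k => if k ∈ s then 1 else 0

theorem indicatorWord_symmDiff (s t : Finset ι) :
    indicatorWord (s ∆ t) = indicatorWord s + indicatorWord t := by
  funext k
  by_cases hs : k ∈ s <;> by_cases ht : k ∈ t <;>
    simp [indicatorWord, Finset.mem_symmDiff, hs, ht, CharTwo.add_self_eq_zero]

theorem indicatorWord_bijective [Finite ι] :
    Bijective (indicatorWord : Finset ι → ι → ZMod 2) := by
  cases nonempty_fintype ι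
  refine bijective_iff_has_inverse.mpr ⟨fun x => {k | x k = 1}, fun s => ?_, fun x => ?_⟩
  · ext k
    simp [indicatorWord]
  · have hval (a : ZMod 2) : (if a = 1 then 1 else 0) = a := by decide +revert
    funext k
    simp [indicatorWord, hval]

end IndicatorWord

section CommonNeighbours

variable {ι : Type*} [Fintype ι] [DecidableEq ι]

theorem hammingNorm_indicatorWord (s : Finset ι) : hammingNorm (indicatorWord s) = #s := by
  simp [hammingNorm, indicatorWord]

/-- The words at distance `p` from both `x` and `y`. -/
def commonNeighbours (p : ℕ) (x y : ι → ZMod 2) : Finset (ι → ZMod 2) :=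
  {z | hammingDist x z = p ∧ hammingDist y z = p}

theorem commonNeighbours_eq_empty {p : ℕ} {x y : ι → ZMod 2} (h : ¬ Even (hammingDist x y)) :
    commonNeighbours p x y = ∅ := by
  rw [commonNeighbours, Finset.filter_eq_empty_iff]
  rintro z - ⟨hx, hy⟩
  have hx' := even_hammingDist x z
  have hy' := even_hammingDist y z
  have hxy := even_hammingDist x y
  rw [hx] at hx'
  rw [hy] at hy'
  tauto

theorem card_commonNeighbours {p i : ℕ} {x y : ι → ZMod 2} (h : hammingDist x y = 2 * i)
    (hip : i ≤ p) :
    #(commonNeighbours p x y) =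
      (2 * i).choose i * (Fintype.card ι - 2 * i).choose (p - i) := by
  obtain ⟨s, hs⟩ := indicatorWord_bijective.2 (x + y)
  have hcard : #s = 2 * i := by
    rw [← h, hammingDist_eq_hammingNorm_add, ← hs, hammingNorm_indicatorWord]
  rw [← card_filter_card_symmDiff hcard hip]
  symm
  refine Finset.card_bijective (fun t => x + indicatorWord t)
    ((AddGroup.addLeft_bijective x).comp indicatorWord_bijective) fun t => ?_
  have hx : hammingDist x (x + indicatorWord t) = #t := by
    rw [hammingDist_eq_hammingNorm_add, ← add_assoc, ZModModule.add_self, zero_add,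
      hammingNorm_indicatorWord]
  have hy : hammingDist y (x + indicatorWord t) = #(s ∆ t) := by
    rw [hammingDist_eq_hammingNorm_add, ← add_assoc, add_comm y, ← hs, ← indicatorWord_symmDiff,
      hammingNorm_indicatorWord]
  simp only [commonNeighbours, Finset.mem_filter_univ, hx, hy]

variable {n p : ℕ}

theorem two_mul_card_commonNeighbours (hn : n + 1 = 2 * p) {i : ℕ} {x y : BoolCube n}
    (h : hammingDist x y = 2 * i) :
    2 * #(commonNeighbours p x y) = i.centralBinom * (p - i).centralBinom := by
  have hle : hammingDist x y ≤ n := hammingDist_le_card_fintype.trans_eq (Fintype.card_fin n)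
  rw [card_commonNeighbours h (by lia), Fintype.card_fin, show n - 2 * i = 2 * (p - i) - 1 by lia,
    mul_left_comm, two_mul_choose_two_mul_sub_one (by lia), Nat.centralBinom_eq_two_mul_choose i]

theorem even_hammingDist_iff_commonNeighbours_nonempty (hn : n + 1 = 2 * p) {x y : BoolCube n} :
    Even (hammingDist x y) ↔ (commonNeighbours p x y).Nonempty := by
  constructor
  · rintro ⟨i, hi⟩
    have hcard := two_mul_card_commonNeighbours hn (hi.trans (two_mul i).symm)
    have hpos := Nat.mul_pos i.centralBinom_pos (p - i).centralBinom_pos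
    exact Finset.card_pos.mp (by lia)
  · intro h
    by_contra hodd
    exact h.ne_empty (commonNeighbours_eq_empty hodd)

end CommonNeighbours

section FoldedWeight

variable {n p : ℕ}

/-- The weight of `x` up to `w ↔ n + 1 - w`: the distance from `0` to `x` in the cube `C_{n+1}` with
antipodal points identified, whose points are represented by the words of `C_n`. -/
def foldedWeight (x : BoolCube n) : ℕ := min (hammingNorm x) (n + 1 - hammingNorm x)

theorem hammingNorm_le (x : BoolCube n) : hammingNorm x ≤ n :=
  hammingNorm_le_card_fintype.trans_eq (Fintype.card_fin n)

theorem foldedWeight_eq_zero {x : BoolCube n} : foldedWeight x = 0 ↔ x = 0 := by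
  have hle := hammingNorm_le x
  rw [← hammingNorm_eq_zero, foldedWeight]
  lia

theorem foldedWeight_eq_half (hn : n + 1 = 2 * p) {x : BoolCube n} :
    foldedWeight x = p ↔ hammingNorm x = p := by
  rw [foldedWeight]
  lia

theorem even_foldedWeight (hn : n + 1 = 2 * p) (x : BoolCube n) :
    Even (foldedWeight x) ↔ Even (hammingNorm x) := by
  have hle := hammingNorm_le x
  rw [foldedWeight]
  grind

theorem two_mul_card_commonNeighbours_eq_foldedWeight (hn : n + 1 = 2 * p) {x y : BoolCube n}
    (hxy : Even (hammingDist x y)) :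
    2 * #(commonNeighbours p x y) =
      (foldedWeight (x + y) / 2).centralBinom * (p - foldedWeight (x + y) / 2).centralBinom := by
  obtain ⟨i, hi⟩ := hxy.two_dvd
  have hle := hammingNorm_le (x + y)
  rw [two_mul_card_commonNeighbours hn hi, foldedWeight]
  rw [← hammingDist_eq_hammingNorm_add, hi] at hle ⊢
  rcases le_total (2 * i) (n + 1 - 2 * i) with h | h
  · rw [min_eq_left h, Nat.mul_div_cancel_left i two_pos]
  · rw [min_eq_right h, show (n + 1 - 2 * i) / 2 = p - i by lia, Nat.sub_sub_self (by lia),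
      mul_comm]

theorem foldedWeight_add_eq_of_card_commonNeighbours_eq (hn : n + 1 = 2 * p)
    {x y x' y' : BoolCube n} (hxy : Even (hammingDist x y))
    (hcard : #(commonNeighbours p x' y') = #(commonNeighbours p x y)) :
    foldedWeight (x' + y') = foldedWeight (x + y) := by
  have hxy' : Even (hammingDist x' y') := by
    rwa [even_hammingDist_iff_commonNeighbours_nonempty hn, ← Finset.card_pos, hcard,
      Finset.card_pos, ← even_hammingDist_iff_commonNeighbours_nonempty hn]
  have hmem (z : BoolCube n) : foldedWeight z / 2 ∈ Set.Iic (p / 2) := by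
    rw [Set.mem_Iic, foldedWeight]
    lia
  have hhalf : foldedWeight (x' + y') / 2 = foldedWeight (x + y) / 2 := by
    refine (strictAntiOn_centralBinom_mul p).injOn (hmem _) (hmem _) ?_
    rw [← two_mul_card_commonNeighbours_eq_foldedWeight hn hxy, ← hcard,
      two_mul_card_commonNeighbours_eq_foldedWeight hn hxy']
  rw [hammingDist_eq_hammingNorm_add, ← even_foldedWeight hn] at hxy hxy'
  rw [← Nat.div_two_mul_two_of_even hxy, ← Nat.div_two_mul_two_of_even hxy', hhalf]

end FoldedWeight

section WeakIsometry

variable {n p : ℕ} {P : Set ℕ} {φ : BoolCube n → BoolCube n}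

theorem IsWeakIsometry.translate (hφ : IsWeakIsometry P φ) (a b : BoolCube n) :
    IsWeakIsometry P fun x => φ (x + a) + b := by
  refine ⟨(AddGroup.addRight_bijective b).comp (hφ.1.comp (AddGroup.addRight_bijective a)), ?_⟩
  intro p hp x y hxy
  rw [hammingDist_add_right]
  exact hφ.2 p hp _ _ (by rw [hammingDist_add_right, hxy])

theorem IsWeakIsometry.hammingDist_eq_iff (hφ : IsWeakIsometry P φ) (hp : p ∈ P)
    {x y : BoolCube n} : hammingDist (φ x) (φ y) = p ↔ hammingDist x y = p := by
  refine ⟨fun h => ?_, hφ.2 p hp x y⟩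
  let e : Equiv.Perm (BoolCube n) := Equiv.ofBijective φ hφ.1
  let S : Set (BoolCube n × BoolCube n) := {z | hammingDist z.1 z.2 = p}
  have hmaps : Set.MapsTo (e.prodCongr e) S S := fun z hz => hφ.2 p hp z.1 z.2 hz
  simpa [S, e] using Equiv.Perm.perm_symm_mapsTo_of_mapsTo _ hmaps (x := (φ x, φ y)) h

theorem IsWeakIsometry.card_commonNeighbours (hφ : IsWeakIsometry P φ) (hp : p ∈ P)
    (x y : BoolCube n) : #(commonNeighbours p (φ x) (φ y)) = #(commonNeighbours p x y) := by
  refine (Finset.card_bijective φ hφ.1 fun z => ?_).symm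
  simp only [commonNeighbours, Finset.mem_filter_univ, hφ.hammingDist_eq_iff hp]

theorem IsWeakIsometry.even_hammingDist_iff (hφ : IsWeakIsometry P φ) (hp : p ∈ P)
    (hn : n + 1 = 2 * p) (x y : BoolCube n) :
    Even (hammingDist (φ x) (φ y)) ↔ Even (hammingDist x y) := by
  rw [even_hammingDist_iff_commonNeighbours_nonempty hn,
    even_hammingDist_iff_commonNeighbours_nonempty hn, ← Finset.card_pos,
    hφ.card_commonNeighbours hp, Finset.card_pos]

theorem IsWeakIsometry.foldedWeight_add (hφ : IsWeakIsometry P φ) (hp : p ∈ P)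
    (hn : n + 1 = 2 * p) {x y : BoolCube n} (hxy : Even (hammingDist x y)) :
    foldedWeight (φ x + φ y) = foldedWeight (x + y) :=
  foldedWeight_add_eq_of_card_commonNeighbours_eq hn hxy (hφ.card_commonNeighbours hp x y)

end WeakIsometry

section FoldedWord

variable {n : ℕ}

/-- The quotient map from `C_{n+1}`, with an extra coordinate `none`, onto `C_n` that identifies
antipodal words. -/
def foldWord : (Option (Fin n) → ZMod 2) →+ BoolCube n where
  toFun u k := u (some k) + u none
  map_zero' := funext fun _ => add_zero 0
  map_add' _ _ := funext fun _ => add_add_add_comm _ _ _ _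

/-- The word of `C_n` represented by a set of coordinates of `C_{n+1}`; complementary sets represent
the same word. -/
def foldedWord (s : Finset (Option (Fin n))) : BoolCube n := foldWord (indicatorWord s)

theorem foldedWord_symmDiff (s t : Finset (Option (Fin n))) :
    foldedWord (s ∆ t) = foldedWord s + foldedWord t := by
  rw [foldedWord, indicatorWord_symmDiff, map_add, foldedWord, foldedWord]

theorem foldedWord_compl (s : Finset (Option (Fin n))) : foldedWord sᶜ = foldedWord s := by
  funext k
  by_cases hk : some k ∈ s <;> by_cases h : none ∈ s <;>
    simp [foldedWord, foldWord, indicatorWord, hk, h, CharTwo.add_self_eq_zero]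

theorem hammingNorm_foldedWord {s : Finset (Option (Fin n))} (hs : none ∉ s) :
    hammingNorm (foldedWord s) = #s := by
  have hword : foldedWord s = indicatorWord s.eraseNone := by
    funext k
    simp [foldedWord, foldWord, indicatorWord, hs]
  rw [hword, hammingNorm_indicatorWord, Finset.card_eraseNone_of_not_mem hs]

theorem exists_foldedWord_eq_of_none_notMem (x : BoolCube n) :
    ∃ s, none ∉ s ∧ foldedWord s = x := by
  obtain ⟨s, rfl⟩ := indicatorWord_bijective.2 x
  refine ⟨s.map Embedding.some, by simp, ?_⟩
  funext k
  simp [foldedWord, foldWord, indicatorWord]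

theorem card_compl_option (s : Finset (Option (Fin n))) : #sᶜ = n + 1 - #s := by
  rw [Finset.card_compl, Fintype.card_option, Fintype.card_fin]

theorem foldedWeight_foldedWord (s : Finset (Option (Fin n))) :
    foldedWeight (foldedWord s) = min #s (n + 1 - #s) := by
  by_cases hs : none ∈ s
  · have hle : #s ≤ n + 1 := by simpa using s.card_le_univ
    rw [← foldedWord_compl, foldedWeight, hammingNorm_foldedWord (by simpa using hs),
      card_compl_option, min_comm, Nat.sub_sub_self hle]
  · rw [foldedWeight, hammingNorm_foldedWord hs]

theorem exists_foldedWord_eq (x : BoolCube n) : ∃ s, foldedWord s = x ∧ #s = foldedWeight x := by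
  obtain ⟨s, -, rfl⟩ := exists_foldedWord_eq_of_none_notMem x
  rw [foldedWeight_foldedWord]
  rcases min_choice #s (n + 1 - #s) with h | h
  · exact ⟨s, rfl, h.symm⟩
  · exact ⟨sᶜ, foldedWord_compl s, by rw [h, card_compl_option]⟩

theorem eq_of_foldedWord_eq {s t : Finset (Option (Fin n))} (hst : #s + #t ≤ n)
    (h : foldedWord s = foldedWord t) : s = t := by
  have hzero : foldedWeight (foldedWord (s ∆ t)) = 0 := by
    rw [foldedWord_symmDiff, h, ZModModule.add_self, foldedWeight_eq_zero]
  have hcard := card_symmDiff_add_two_mul_card_inter s t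
  rw [foldedWeight_foldedWord] at hzero
  rw [← symmDiff_eq_bot, Finset.bot_eq_empty, ← Finset.card_eq_zero]
  lia

end FoldedWord

section FoldPerm

variable {n p : ℕ} (π : Equiv.Perm (Option (Fin n)))

/-- The map induced on `C_n` by a permutation of the `n + 1` coordinates of `C_{n+1}`. -/
def foldPerm : BoolCube n →+ BoolCube n where
  toFun x := foldWord fun v => (π.symm v).elim 0 x
  map_zero' := by
    rw [← map_zero foldWord]
    congr 1
    funext v
    cases π.symm v <;> rfl
  map_add' x y := by
    rw [← map_add]
    congr 1
    funext v
    cases h : π.symm v <;> simp [h]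

theorem foldPerm_apply (x : BoolCube n) (k : Fin n) :
    foldPerm π x k = (π.symm (some k)).elim 0 x + (π.symm none).elim 0 x := rfl

theorem foldPerm_foldedWord (s : Finset (Option (Fin n))) :
    foldPerm π (foldedWord s) = foldedWord (s.map π.toEmbedding) := by
  have helim (v : Option (Fin n)) :
      v.elim 0 (foldedWord s) = indicatorWord s v + indicatorWord s none := by
    cases v
    · exact (CharTwo.add_self_eq_zero _).symm
    · rfl
  have hmap (v : Option (Fin n)) :
      indicatorWord s (π.symm v) = indicatorWord (s.map π.toEmbedding) v := by
    simp only [indicatorWord, Finset.mem_map_equiv]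
  funext k
  rw [foldPerm_apply, helim, helim, hmap, hmap]
  calc _ = (indicatorWord (s.map π.toEmbedding) (some k) +
            indicatorWord (s.map π.toEmbedding) none) +
          (indicatorWord s none + indicatorWord s none) := by ring
    _ = _ := by rw [CharTwo.add_self_eq_zero, add_zero]; rfl

theorem foldPerm_bijective : Bijective (foldPerm π) := by
  refine Finite.injective_iff_bijective.mp (LeftInverse.injective (g := foldPerm π.symm) ?_)
  intro x
  obtain ⟨s, -, rfl⟩ := exists_foldedWord_eq_of_none_notMem x
  rw [foldPerm_foldedWord, foldPerm_foldedWord, Finset.map_map, ← Equiv.trans_toEmbedding,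
    Equiv.self_trans_symm, Equiv.refl_toEmbedding, Finset.map_refl]

theorem foldedWeight_foldPerm (x : BoolCube n) : foldedWeight (foldPerm π x) = foldedWeight x := by
  obtain ⟨s, -, rfl⟩ := exists_foldedWord_eq_of_none_notMem x
  rw [foldPerm_foldedWord, foldedWeight_foldedWord, foldedWeight_foldedWord, Finset.card_map]

theorem isWeakIsometry_foldPerm (hn : n + 1 = 2 * p) : IsWeakIsometry {p} (foldPerm π) := by
  refine ⟨foldPerm_bijective π, ?_⟩
  rintro q rfl x y hxy
  rw [hammingDist_eq_hammingNorm_add] at hxy ⊢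
  rwa [← map_add, ← foldedWeight_eq_half hn, foldedWeight_foldPerm, foldedWeight_eq_half hn]

variable {π}

theorem isCubeIsometry_foldPerm (hπ : π none = none) : IsCubeIsometry (foldPerm π) := by
  refine ⟨foldPerm_bijective π, fun x y => ?_⟩
  rw [hammingDist_eq_hammingNorm_add, hammingDist_eq_hammingNorm_add, ← map_add]
  obtain ⟨s, hs, hx⟩ := exists_foldedWord_eq_of_none_notMem (x + y)
  have hmap : none ∉ s.map π.toEmbedding := by
    rwa [Finset.mem_map_equiv, π.symm_apply_eq.mpr hπ.symm]
  rw [← hx, foldPerm_foldedWord, hammingNorm_foldedWord hs, hammingNorm_foldedWord hmap,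
    Finset.card_map]

end FoldPerm

section SigmaMapping

variable {n : ℕ} {φ : BoolCube n → BoolCube n}

theorem isSigmaMappingOf_iff {i j : Fin n} {σ : {k : Fin n // k ≠ i} ≃ {k : Fin n // k ≠ j}} :
    IsSigmaMappingOf i j σ φ ↔
      ∀ c, φ c j = c i ∧ ∀ k : {k : Fin n // k ≠ j}, φ c k = c (σ.symm k) + c i := by
  refine forall_congr' fun c => ?_
  have hbit (a : ZMod 2) : a = 0 ∨ a = 1 := by decide +revert
  rcases hbit (c i) with h | h <;> simp [h, and_comm]

theorem isSigmaMappingOf_iff_eq_foldPerm {i j : Fin n}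
    {σ : {k : Fin n // k ≠ i} ≃ {k : Fin n // k ≠ j}} {τ : Equiv.Perm (Fin n)} (hi : τ i = j)
    (hσ : ∀ k : {k : Fin n // k ≠ i}, τ k = σ k) :
    IsSigmaMappingOf i j σ φ ↔
      φ = foldPerm (τ.optionCongr.trans (Equiv.swap none (some j))) := by
  set π : Equiv.Perm (Option (Fin n)) := τ.optionCongr.trans (Equiv.swap none (some j)) with hπ
  have hnone : π.symm none = some i := π.symm_apply_eq.mpr (by simp [hπ, hi])
  have hsome : π.symm (some j) = none := π.symm_apply_eq.mpr (by simp [hπ])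
  have hne (k : {k : Fin n // k ≠ j}) : π.symm (some k) = some (σ.symm k).1 := by
    rw [π.symm_apply_eq, hπ, Equiv.trans_apply, Equiv.optionCongr_apply, Option.map_some, hσ,
      σ.apply_symm_apply, Equiv.swap_apply_of_ne_of_ne (Option.some_ne_none _)]
    exact fun h => k.2 (Option.some_injective _ h)
  have hj (c : BoolCube n) : foldPerm π c j = c i := by
    rw [foldPerm_apply, hsome, hnone]
    exact zero_add _
  have hk (c : BoolCube n) (k : {k : Fin n // k ≠ j}) :
      foldPerm π c k = c (σ.symm k) + c i := by
    rw [foldPerm_apply, hne, hnone]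
    rfl
  rw [isSigmaMappingOf_iff]
  constructor
  · intro h
    funext c k
    by_cases hkj : k = j
    · rw [hkj, (h c).1, hj]
    · rw [(h c).2 ⟨k, hkj⟩, hk c ⟨k, hkj⟩]
  · rintro rfl c
    exact ⟨hj c, hk c⟩

theorem isSigmaMapping_iff :
    IsSigmaMapping φ ↔ ∃ π : Equiv.Perm (Option (Fin n)), π none ≠ none ∧ φ = foldPerm π := by
  constructor
  · rintro ⟨i, j, σ, h⟩
    have hi : σ.extendSubtype i = j := not_not.mp (σ.extendSubtype_not_mem i (not_not.mpr rfl))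
    refine ⟨σ.extendSubtype.optionCongr.trans (Equiv.swap none (some j)), by simp, ?_⟩
    exact (isSigmaMappingOf_iff_eq_foldPerm hi fun k => σ.extendSubtype_apply_of_mem k k.2).mp h
  · rintro ⟨π, hπ, rfl⟩
    obtain ⟨j, hj⟩ := Option.ne_none_iff_exists.mp hπ
    let τ : Equiv.Perm (Fin n) := Equiv.removeNone π
    have hτ : τ.optionCongr.trans (Equiv.swap none (some j)) = π := by
      rw [hj]
      ext1 v
      rw [Equiv.trans_apply, map_equiv_removeNone]
      simp
    refine ⟨τ.symm j, j, τ.subtypeEquiv fun a => not_congr τ.eq_symm_apply, ?_⟩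
    rw [isSigmaMappingOf_iff_eq_foldPerm (τ.apply_symm_apply j) fun _ => rfl, hτ]

end SigmaMapping

section Pairs

theorem exists_perm_eq_map_of_injective {V : Type*} [Finite V] {f : Finset V → Finset V}
    {g : V → V} (hg : Injective g) (hcard : ∀ s, #s = 2 → #(f s) = 2)
    (hmem : ∀ s, #s = 2 → ∀ a ∈ s, g a ∈ f s) :
    ∃ π : Equiv.Perm V, ∀ s, #s = 2 → f s = s.map π.toEmbedding := by
  refine ⟨Equiv.ofBijective g (Finite.injective_iff_bijective.mp hg), fun s hs => Eq.symm ?_⟩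
  refine Finset.eq_of_subset_of_card_le (fun v hv => ?_) (by rw [hcard s hs, Finset.card_map, hs])
  obtain ⟨a, ha, rfl⟩ := Finset.mem_map.mp hv
  exact hmem s hs a ha

variable {V : Type*} [DecidableEq V]

theorem exists_ne_eq_pair_of_mem {s : Finset V} {a : V} (hs : #s = 2) (ha : a ∈ s) :
    ∃ b, a ≠ b ∧ s = {a, b} := by
  obtain ⟨x, y, hxy, rfl⟩ := Finset.card_eq_two.mp hs
  rcases Finset.mem_insert.mp ha with rfl | hy
  · exact ⟨y, hxy, rfl⟩
  · rw [Finset.mem_singleton.mp hy]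
    exact ⟨x, hxy.symm, Finset.pair_comm x y⟩

theorem pair_symmDiff_singleton {a b : V} (h : a ≠ b) : ({a, b} : Finset V) ∆ {a} = {b} := by
  grind [Finset.mem_symmDiff]

theorem exists_mem_of_intersecting_pairs {F : Finset (Finset V)} (hpair : ∀ s ∈ F, #s = 2)
    (hF : (F : Set (Finset V)).Intersecting) (hcard : 4 ≤ #F) : ∃ a, ∀ s ∈ F, a ∈ s := by
  by_contra! hcommon
  have hmeet {s t : Finset V} (hs : s ∈ F) (ht : t ∈ F) : ∃ x ∈ s, x ∈ t :=
    Finset.not_disjoint_iff.mp (hF hs ht)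
  obtain ⟨s, hs⟩ := Finset.card_pos.mp (show 0 < #F by lia)
  obtain ⟨a, b, hab, rfl⟩ := Finset.card_eq_two.mp (hpair s hs)
  obtain ⟨t, ht, hat⟩ := hcommon a
  have hbt : b ∈ t := by
    have h := hmeet hs ht
    grind
  obtain ⟨c, hbc, rfl⟩ := exists_ne_eq_pair_of_mem (hpair t ht) hbt
  obtain ⟨u, hu, hbu⟩ := hcommon b
  have hau : a ∈ u := by
    have h := hmeet hs hu
    grind
  have hcu : c ∈ u := by
    have h := hmeet ht hu
    grind
  have hac : a ≠ c := by grind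
  obtain rfl : u = {a, c} := by
    obtain ⟨x, -, rfl⟩ := exists_ne_eq_pair_of_mem (hpair u hu) hau
    grind
  have hsub : F ⊆ Finset.powersetCard 2 {a, b, c} := by
    intro v hv
    refine Finset.mem_powersetCard.mpr ⟨?_, hpair v hv⟩
    obtain ⟨x, y, -, rfl⟩ := Finset.card_eq_two.mp (hpair v hv)
    have h₁ := hmeet hs hv
    have h₂ := hmeet ht hv
    have h₃ := hmeet hu hv
    grind
  have hle := Finset.card_le_card hsub
  rw [Finset.card_powersetCard, Finset.card_eq_three.mpr ⟨a, b, c, hab, hac, hbc, rfl⟩] at hle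
  exact absurd (hcard.trans hle) (by decide)

variable [Fintype V]

/-- The two-element sets that contain `a`. -/
def pairsThrough (a : V) : Finset (Finset V) := {s | #s = 2 ∧ a ∈ s}

theorem mem_pairsThrough {a : V} {s : Finset V} : s ∈ pairsThrough a ↔ #s = 2 ∧ a ∈ s :=
  Finset.mem_filter_univ _

theorem card_pairsThrough (a : V) : #(pairsThrough a) = Fintype.card V - 1 := by
  rw [← Finset.card_univ, ← Finset.card_erase_of_mem (Finset.mem_univ a)]
  symm
  refine Finset.card_nbij (fun b => {a, b}) ?_ ?_ ?_
  · intro b hb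
    rw [Finset.mem_coe, mem_pairsThrough]
    exact ⟨Finset.card_pair (Finset.ne_of_mem_erase hb).symm, Finset.mem_insert_self a _⟩
  · intro b hb c _ h
    have hbc : b ∈ ({a, c} : Finset V) :=
      (show ({a, b} : Finset V) = {a, c} from h) ▸ by simp
    exact Finset.mem_singleton.mp (Finset.mem_of_mem_insert_of_ne hbc (Finset.ne_of_mem_erase hb))
  · intro s hs
    obtain ⟨hs, ha⟩ := mem_pairsThrough.mp hs
    obtain ⟨b, hab, rfl⟩ := exists_ne_eq_pair_of_mem hs ha
    exact ⟨b, by simp [hab.symm], rfl⟩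

end Pairs

/-- Whitney's theorem on line graphs, for complete graphs. With four vertices it fails, as a star
can be exchanged with a triangle. -/
theorem exists_perm_eq_map_of_intersecting {V : Type*} [Fintype V] {f : Finset V → Finset V}
    (hV : 5 ≤ Fintype.card V) (hcard : ∀ s, #s = 2 → #(f s) = 2) (hinj : Set.InjOn f {s | #s = 2})
    (hmeet : ∀ s t, #s = 2 → #t = 2 → ¬ Disjoint s t → ¬ Disjoint (f s) (f t)) :
    ∃ π : Equiv.Perm V, ∀ s, #s = 2 → f s = s.map π.toEmbedding := by
  classical
  have hinjOn (a : V) : Set.InjOn f (pairsThrough a) :=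
    hinj.mono fun s hs => (mem_pairsThrough.mp hs).1
  have hcommon (a : V) : ∃ b, ∀ t ∈ (pairsThrough a).image f, b ∈ t := by
    refine exists_mem_of_intersecting_pairs ?_ ?_ ?_
    · exact Finset.forall_mem_image.mpr fun s hs => hcard s (mem_pairsThrough.mp hs).1
    · rw [Finset.coe_image]
      rintro _ ⟨s, hs, rfl⟩ _ ⟨t, ht, rfl⟩
      obtain ⟨hs, has⟩ := mem_pairsThrough.mp hs
      obtain ⟨ht, hat⟩ := mem_pairsThrough.mp ht
      exact hmeet s t hs ht (Finset.not_disjoint_iff.mpr ⟨a, has, hat⟩)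
    · rw [Finset.card_image_of_injOn (hinjOn a), card_pairsThrough]
      lia
  choose g hg using hcommon
  simp only [Finset.forall_mem_image, mem_pairsThrough] at hg
  have hmem (s : Finset V) (hs : #s = 2) (a : V) (ha : a ∈ s) : g a ∈ f s := hg a ⟨hs, ha⟩
  refine exists_perm_eq_map_of_injective (fun a b hab => ?_) hcard hmem
  have hsurj : Set.SurjOn f (pairsThrough b) (pairsThrough (g b)) := by
    refine Finset.surjOn_of_injOn_of_card_le f (fun s hs => ?_) (hinjOn b) ?_
    · obtain ⟨hs, hb⟩ := mem_pairsThrough.mp hs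
      exact mem_pairsThrough.mpr ⟨hcard s hs, hmem s hs b hb⟩
    · rw [card_pairsThrough, card_pairsThrough]
  obtain ⟨c, hc⟩ := Finset.exists_mem_notMem_of_card_lt_card
    (show #({a, b} : Finset V) < #Finset.univ from
      Finset.card_le_two.trans_lt (by rw [Finset.card_univ]; lia))
  have hac : #({a, c} : Finset V) = 2 := Finset.card_pair (by grind)
  obtain ⟨s, hs, hfs⟩ := hsurj (mem_pairsThrough.mpr
    ⟨hcard _ hac, hab ▸ hmem {a, c} hac a (Finset.mem_insert_self a _)⟩)
  obtain ⟨hs, hb⟩ := mem_pairsThrough.mp hs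
  rw [hinj hs hac hfs] at hb
  grind

section FoldedPairs

variable {n p : ℕ} {P : Set ℕ} {φ : BoolCube n → BoolCube n}

theorem not_disjoint_iff_foldedWeight_add_le_two (hn : 6 ≤ n) {s t : Finset (Option (Fin n))}
    (hs : #s = 2) (ht : #t = 2) :
    ¬ Disjoint s t ↔ foldedWeight (foldedWord s + foldedWord t) ≤ 2 := by
  have hcard := card_symmDiff_add_two_mul_card_inter s t
  rw [← foldedWord_symmDiff, foldedWeight_foldedWord, Finset.disjoint_iff_inter_eq_empty,
    ← Finset.card_eq_zero]
  lia

theorem mem_of_foldedWeight_add_eq_one (hn : 4 ≤ n) {s : Finset (Option (Fin n))}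
    {a : Option (Fin n)} (hs : #s = 2)
    (h : foldedWeight (foldedWord s + foldedWord {a}) = 1) : a ∈ s := by
  by_contra ha
  have hcard := card_symmDiff_add_two_mul_card_inter s {a}
  rw [Finset.inter_singleton_of_notMem ha, Finset.card_empty, Finset.card_singleton] at hcard
  rw [← foldedWord_symmDiff, foldedWeight_foldedWord] at h
  lia

theorem IsWeakIsometry.foldedWeight_add_eq_one (hφ : IsWeakIsometry P φ) (hp : 3 ∈ P)
    (hn : n = 5) {x y : BoolCube n} (h : foldedWeight (x + y) = 1) :
    foldedWeight (φ x + φ y) = 1 := by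
  have hparity := hφ.even_hammingDist_iff hp (by lia) x y
  have hthree := hφ.hammingDist_eq_iff hp (x := x) (y := y)
  simp only [hammingDist_eq_hammingNorm_add] at hparity hthree
  have hle := hammingNorm_le (x + y)
  have hle' := hammingNorm_le (φ x + φ y)
  rw [foldedWeight] at h ⊢
  grind

theorem IsWeakIsometry.exists_pair_map (hφ : IsWeakIsometry P φ) (hp : p ∈ P)
    (hn : n + 1 = 2 * p) (hp' : 3 ≤ p) (hφ0 : φ 0 = 0) :
    ∃ f : Finset (Option (Fin n)) → Finset (Option (Fin n)),
      (∀ s, foldedWord (f s) = φ (foldedWord s)) ∧ (∀ s, #s = 2 → #(f s) = 2) ∧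
        Set.InjOn f {s | #s = 2} := by
  choose f hf hfcard using fun s : Finset (Option (Fin n)) =>
    exists_foldedWord_eq (φ (foldedWord s))
  refine ⟨f, hf, fun s hs => ?_, fun s hs t ht hst => ?_⟩
  · have hweight : foldedWeight (foldedWord s) = 2 := by
      rw [foldedWeight_foldedWord]
      lia
    have heven : Even (hammingDist (foldedWord s) 0) := by
      rw [hammingDist_zero_right, ← even_foldedWeight hn, hweight]
      exact even_two
    rw [hfcard, ← hweight]
    simpa only [hφ0, add_zero] using hφ.foldedWeight_add hp hn heven
  · rw [Set.mem_ofPred_eq] at hs ht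
    exact eq_of_foldedWord_eq (by lia) (hφ.1.1 (by rw [← hf, ← hf, hst]))

theorem IsWeakIsometry.exists_foldPerm_of_three_mem (hφ : IsWeakIsometry P φ) (hp : 3 ∈ P)
    (hn : n = 5) (hφ0 : φ 0 = 0) :
    ∃ π : Equiv.Perm (Option (Fin n)),
      ∀ s, #s = 2 → φ (foldedWord s) = foldPerm π (foldedWord s) := by
  obtain ⟨f, hf, hcard, -⟩ := hφ.exists_pair_map hp (by lia) le_rfl hφ0
  have hsingle (a : Option (Fin n)) : foldedWeight (foldedWord {a}) = 1 := by
    rw [foldedWeight_foldedWord, Finset.card_singleton]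
    lia
  have hpoint (a : Option (Fin n)) : ∃ b, foldedWord {b} = φ (foldedWord {a}) := by
    have hone := hφ.foldedWeight_add_eq_one hp hn (x := foldedWord {a}) (y := 0)
      (by rw [add_zero, hsingle])
    obtain ⟨t, ht, htcard⟩ := exists_foldedWord_eq (φ (foldedWord {a}))
    rw [hφ0, add_zero] at hone
    obtain ⟨b, rfl⟩ := Finset.card_eq_one.mp (htcard.trans hone)
    exact ⟨b, ht⟩
  choose g hg using hpoint
  have hinj : Injective g := by
    intro a b hab
    have hab : φ (foldedWord {a}) = φ (foldedWord {b}) := by rw [← hg, ← hg, hab]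
    refine Finset.singleton_injective (eq_of_foldedWord_eq ?_ (hφ.1.1 hab))
    rw [Finset.card_singleton, Finset.card_singleton]
    lia
  have hmem (s : Finset (Option (Fin n))) (hs : #s = 2) (a) (ha : a ∈ s) : g a ∈ f s := by
    refine mem_of_foldedWeight_add_eq_one (by lia) (hcard s hs) ?_
    obtain ⟨b, hab, rfl⟩ := exists_ne_eq_pair_of_mem hs ha
    rw [hf, hg]
    refine hφ.foldedWeight_add_eq_one hp hn ?_
    rw [← foldedWord_symmDiff, pair_symmDiff_singleton hab, hsingle]
  obtain ⟨π, hπ⟩ := exists_perm_eq_map_of_injective hinj hcard hmem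
  exact ⟨π, fun s hs => by rw [foldPerm_foldedWord, ← hπ s hs, hf]⟩

theorem IsWeakIsometry.exists_foldPerm_of_four_le (hφ : IsWeakIsometry P φ) (hp : p ∈ P)
    (hn : n + 1 = 2 * p) (hp' : 4 ≤ p) (hφ0 : φ 0 = 0) :
    ∃ π : Equiv.Perm (Option (Fin n)),
      ∀ s, #s = 2 → φ (foldedWord s) = foldPerm π (foldedWord s) := by
  obtain ⟨f, hf, hcard, hinj⟩ := hφ.exists_pair_map hp hn (by lia) hφ0
  have hmeet (s t : Finset (Option (Fin n))) (hs : #s = 2) (ht : #t = 2) (hst : ¬ Disjoint s t) :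
      ¬ Disjoint (f s) (f t) := by
    have heven {u : Finset (Option (Fin n))} (hu : #u = 2) :
        Even (hammingNorm (foldedWord u)) := by
      rw [← even_foldedWeight hn, foldedWeight_foldedWord, hu, min_eq_left (by lia)]
      exact even_two
    have hdist : Even (hammingDist (foldedWord s) (foldedWord t)) :=
      (even_hammingDist _ _).mpr (iff_of_true (heven hs) (heven ht))
    rw [not_disjoint_iff_foldedWeight_add_le_two (by lia) (hcard s hs) (hcard t ht), hf, hf,
      hφ.foldedWeight_add hp hn hdist]
    exact (not_disjoint_iff_foldedWeight_add_le_two (by lia) hs ht).mp hst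
  have hV : 5 ≤ Fintype.card (Option (Fin n)) := by
    rw [Fintype.card_option, Fintype.card_fin]
    lia
  obtain ⟨π, hπ⟩ := exists_perm_eq_map_of_intersecting hV hcard hinj hmeet
  exact ⟨π, fun s hs => by rw [foldPerm_foldedWord, ← hπ s hs, hf]⟩

/-- The two-element sets that meet are those at folded distance at most `2`, except for `n = 5`,
where the sum of two disjoint pairs is also represented by a pair; there the odd distances other
than `3` take over. -/
theorem IsWeakIsometry.exists_foldPerm_foldedWord_eq (hφ : IsWeakIsometry P φ) (hp : p ∈ P)
    (hn : n + 1 = 2 * p) (hp' : 3 ≤ p) (hφ0 : φ 0 = 0) :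
    ∃ π : Equiv.Perm (Option (Fin n)),
      ∀ s, #s = 2 → φ (foldedWord s) = foldPerm π (foldedWord s) := by
  obtain rfl | hp' := hp'.eq_or_lt
  · exact hφ.exists_foldPerm_of_three_mem hp (by lia) hφ0
  · exact hφ.exists_foldPerm_of_four_le hp hn hp' hφ0

end FoldedPairs

section Differences

variable {ι G H : Type*} [AddCommGroup G] [AddCommGroup H] {u : ι → G} {φ : G → H}
  {F : G → G →+ H}

theorem map_sub_eq_of_forall_add_sub (h : ∀ x a b, φ (x + (u a - u b)) = φ x + F x (u a - u b))
    (x : G) (a b c d : ι) : F (x + (u a - u b)) (u c - u d) = F x (u c - u d) := by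
  -- The path from `x` to `x + (u a - u b) + (u e - u a)` can be shortened to `x + (u e - u b)`.
  have hstart (e : ι) : F (x + (u a - u b)) (u e - u a) = F x (u e - u a) := by
    have hpath := h (x + (u a - u b)) e a
    rw [add_assoc, add_comm (u a - u b), sub_add_sub_cancel, h, h, add_assoc, add_left_cancel_iff,
      ← sub_eq_iff_eq_add', ← map_sub, sub_sub_sub_cancel_right] at hpath
    exact hpath.symm
  rw [← sub_sub_sub_cancel_right (u c) (u d) (u a), map_sub, hstart, hstart, ← map_sub]

theorem eq_add_of_mem_closure_sub (h : ∀ x a b, φ (x + (u a - u b)) = φ x + F x (u a - u b))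
    {x : G} (hx : x ∈ AddSubmonoid.closure {d | ∃ a b, d = u a - u b}) : φ x = φ 0 + F 0 x := by
  have hpath : φ x = φ 0 + F 0 x ∧ ∀ a b, F x (u a - u b) = F 0 (u a - u b) := by
    induction hx using AddSubmonoid.closure_induction_right with
    | zero => exact ⟨by rw [map_zero, add_zero], fun _ _ => rfl⟩
    | add_right x _ d hd ih =>
      obtain ⟨a, b, rfl⟩ := hd
      refine ⟨by rw [h, ih.1, ih.2, map_add, add_assoc], fun c d => ?_⟩
      rw [map_sub_eq_of_forall_add_sub h, ih.2]
  exact hpath.1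

end Differences

section EvenWords

variable {n p : ℕ} {P : Set ℕ} {φ : BoolCube n → BoolCube n}

theorem foldedWord_eq_sum (s : Finset (Option (Fin n))) :
    foldedWord s = ∑ a ∈ s, foldedWord {a} := by
  simp only [foldedWord, ← map_sum]
  congr 1
  funext k
  simp [indicatorWord]

theorem mem_closure_of_mem_evenWords {x : BoolCube n} (hx : x ∈ evenWords n) :
    x ∈ AddSubmonoid.closure {d | ∃ a b, d = foldedWord {a} - foldedWord {b}} := by
  obtain ⟨s, hs, rfl⟩ := exists_foldedWord_eq_of_none_notMem x
  have hcard : Even #s := by rwa [← hammingNorm_foldedWord hs]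
  have hsum : foldedWord s = ∑ a ∈ s, (foldedWord {a} - foldedWord {none}) := by
    rw [Finset.sum_sub_distrib, Finset.sum_const, ← foldedWord_eq_sum,
      ← Nat.cast_smul_eq_nsmul (ZMod 2), ZMod.natCast_eq_zero_iff_even.mpr hcard, zero_smul,
      sub_zero]
  rw [hsum]
  exact sum_mem fun a _ => AddSubmonoid.subset_closure ⟨a, none, rfl⟩

theorem IsWeakIsometry.exists_foldPerm_eqOn_evenWords (hφ : IsWeakIsometry P φ) (hp : p ∈ P)
    (hn : n + 1 = 2 * p) (hp' : 3 ≤ p) (hφ0 : φ 0 = 0) :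
    ∃ π, Set.EqOn φ (foldPerm π) (evenWords n) := by
  choose π hπ using fun x => (hφ.translate x (φ x)).exists_foldPerm_foldedWord_eq hp hn hp'
    (by rw [zero_add, ZModModule.add_self])
  have hpair (x : BoolCube n) (a b : Option (Fin n)) :
      φ (x + (foldedWord {a} - foldedWord {b})) =
        φ x + foldPerm (π x) (foldedWord {a} - foldedWord {b}) := by
    by_cases hab : a = b
    · rw [hab, sub_self, map_zero, add_zero, add_zero]
    · have hcard : #(({a} : Finset (Option (Fin n))) ∆ {b}) = 2 := by
        rw [(Finset.disjoint_singleton.mpr hab).symmDiff_eq_sup, Finset.sup_eq_union,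
          ← Finset.insert_eq, Finset.card_pair hab]
      rw [ZModModule.sub_eq_add, ← foldedWord_symmDiff, ← hπ x _ hcard, add_comm x,
        add_left_comm, ZModModule.add_self, add_zero]
  refine ⟨π 0, fun x hx => ?_⟩
  rw [eq_add_of_mem_closure_sub hpair (mem_closure_of_mem_evenWords hx), hφ0, zero_add]

theorem IsWeakIsometry.exists_foldPerm_eqOn_oddWords (hφ : IsWeakIsometry P φ) (hp : p ∈ P)
    (hn : n + 1 = 2 * p) (hp' : 3 ≤ p) (hφ0 : φ 0 = 0) :
    ∃ ρ, ∃ a ∈ evenWords n, Set.EqOn φ (cubeTranslation a ∘ foldPerm ρ) (oddWords n) := by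
  let i : Fin n := ⟨0, by lia⟩
  let o : BoolCube n := indicatorWord {i}
  have ho : ¬ Even (hammingNorm o) := by
    rw [hammingNorm_indicatorWord, Finset.card_singleton]
    exact Nat.not_even_one
  obtain ⟨ρ, hρ⟩ := (hφ.translate o (φ o)).exists_foldPerm_eqOn_evenWords hp hn hp'
    (by rw [zero_add, ZModModule.add_self])
  refine ⟨ρ, foldPerm ρ o + φ o, ?_, fun y hy => ?_⟩
  · have hφo := hφ.even_hammingDist_iff hp hn o 0
    rw [hφ0, hammingDist_zero_right, hammingDist_zero_right] at hφo
    have hρo : Even (hammingNorm (foldPerm ρ o)) ↔ Even (hammingNorm o) := by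
      rw [← even_foldedWeight hn, foldedWeight_foldPerm, even_foldedWeight hn]
    exact (even_hammingNorm_add _ _).mpr (hρo.trans hφo.symm)
  · have hyo : y + o ∈ evenWords n :=
      (even_hammingNorm_add _ _).mpr (iff_of_false (Nat.not_even_iff_odd.mpr hy) ho)
    have h : φ (y + o + o) + φ o = foldPerm ρ (y + o) := hρ hyo
    rw [add_assoc, ZModModule.add_self, add_zero, map_add] at h
    rw [comp_apply, cubeTranslation, ← add_assoc, ← h, add_assoc, ZModModule.add_self, add_zero]

end EvenWords

section Isometries

variable {n p : ℕ} {P Q : Set ℕ} {A : Set (BoolCube n)} {φ ψ : BoolCube n → BoolCube n}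

theorem IsWeakIsometry.eq_of_eqOn_evenWords (hφ : IsWeakIsometry P φ) (hψ : IsWeakIsometry Q ψ)
    (hpP : p ∈ P) (hpQ : p ∈ Q) (hn : n + 1 = 2 * p) (hodd : Odd p)
    (h : Set.EqOn φ ψ (evenWords n)) : φ = ψ := by
  funext y
  by_cases hy : Even (hammingNorm y)
  · exact h hy
  have heven {z : BoolCube n} (hz : hammingDist y z = p) : φ z = ψ z := by
    have hparity := even_hammingDist y z
    rw [hz] at hparity
    refine h (show Even (hammingNorm z) from ?_)
    rw [← Nat.not_even_iff_odd] at hodd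
    tauto
  have hcard : #(commonNeighbours p (φ y) (ψ y)) = #(commonNeighbours p y y) := by
    refine (Finset.card_bijective φ hφ.1 fun z => ?_).symm
    simp only [commonNeighbours, Finset.mem_filter_univ, and_self, hφ.hammingDist_eq_iff hpP]
    refine ⟨fun hz => ⟨hz, ?_⟩, And.left⟩
    rw [heven hz, hψ.hammingDist_eq_iff hpQ, hz]
  have hzero := foldedWeight_add_eq_of_card_commonNeighbours_eq hn (by simp) hcard
  rw [ZModModule.add_self, foldedWeight_eq_zero.mpr rfl, foldedWeight_eq_zero] at hzero
  rwa [← sub_eq_zero, ZModModule.sub_eq_add]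

theorem IsCubeIsometry.isEvenIsometry (hφ : IsCubeIsometry φ) : IsEvenIsometry φ :=
  ⟨hφ.1, fun _ _ x y hxy => (hφ.2 x y).trans hxy⟩

theorem IsCubeIsometry.cubeTranslation_comp (hφ : IsCubeIsometry φ) (a : BoolCube n) :
    IsCubeIsometry (cubeTranslation a ∘ φ) :=
  ⟨(AddGroup.addRight_bijective a).comp hφ.1, fun x y =>
    (hammingDist_add_right _ _ a).trans (hφ.2 x y)⟩

theorem isCubeIsometry_or_isSigmaMapping_foldPerm (π : Equiv.Perm (Option (Fin n))) :
    IsCubeIsometry (foldPerm π) ∨ IsSigmaMapping (foldPerm π) := by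
  by_cases hπ : π none = none
  · exact .inl (isCubeIsometry_foldPerm hπ)
  · exact .inr (isSigmaMapping_iff.mpr ⟨π, hπ, rfl⟩)

theorem IsSigmaMapping.isWeakIsometry (hφ : IsSigmaMapping φ) (hn : n + 1 = 2 * p) :
    IsWeakIsometry {p} φ := by
  obtain ⟨π, -, rfl⟩ := isSigmaMapping_iff.mp hφ
  exact isWeakIsometry_foldPerm π hn

theorem IsCubeIsometry.actsAsEvenIsometryOn (hψ : IsCubeIsometry ψ) (h : Set.EqOn φ ψ A) :
    ActsAsEvenIsometryOn φ A :=
  ⟨ψ, hψ.isEvenIsometry, h⟩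

theorem isEvenIsometry_of_actsAsEvenIsometryOn (hφ : Bijective φ)
    (hE : ActsAsEvenIsometryOn φ (evenWords n)) (hO : ActsAsEvenIsometryOn φ (oddWords n)) :
    IsEvenIsometry φ := by
  obtain ⟨ψ, hψ, hφψ⟩ := hE
  obtain ⟨χ, hχ, hφχ⟩ := hO
  refine ⟨hφ, fun q hq x y hxy => ?_⟩
  have hparity := (even_hammingDist x y).mp (hxy ▸ hq.2)
  by_cases hx : Even (hammingNorm x)
  · rw [hφψ hx, hφψ (hparity.mp hx)]
    exact hψ.2 q hq x y hxy
  · have hy := hparity.not.mp hx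
    rw [hφχ (Nat.not_even_iff_odd.mp hx), hφχ (Nat.not_even_iff_odd.mp hy)]
    exact hχ.2 q hq x y hxy

theorem IsWeakIsometry.isCubeIsometry_of_le_one (hφ : IsWeakIsometry P φ) (hp : 1 ∈ P)
    (hn : n ≤ 1) : IsCubeIsometry φ := by
  refine ⟨hφ.1, fun x y => ?_⟩
  have hle := hammingNorm_le (x + y)
  rw [← hammingDist_eq_hammingNorm_add] at hle
  obtain h | h : hammingDist x y = 0 ∨ hammingDist x y = 1 := by lia
  · rw [eq_of_hammingDist_eq_zero h, hammingDist_self, hammingDist_self]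
  · rw [h, hφ.2 1 hp x y h]

theorem IsWeakIsometry.isEvenIsometry_of_le_three (hφ : IsWeakIsometry P φ) (hp : p ∈ P)
    (hn : n + 1 = 2 * p) (hn' : n ≤ 3) : IsEvenIsometry φ := by
  refine ⟨hφ.1, fun q hq => ?_⟩
  obtain ⟨⟨hq₁, hqn⟩, heven⟩ := hq
  obtain rfl : q = p := by grind
  exact hφ.2 q hp

theorem IsWeakIsometry.isCubeIsometry_or_isSigmaMapping (hφ : IsWeakIsometry P φ) (hp : p ∈ P)
    (hn : n + 1 = 2 * p) (hodd : Odd p) (hφ0 : φ 0 = 0) :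
    IsCubeIsometry φ ∨ IsSigmaMapping φ := by
  by_cases hp' : 3 ≤ p
  · obtain ⟨π, hπ⟩ := hφ.exists_foldPerm_eqOn_evenWords hp hn hp' hφ0
    obtain rfl : φ = foldPerm π :=
      hφ.eq_of_eqOn_evenWords (isWeakIsometry_foldPerm π hn) hp rfl hn hodd hπ
    exact isCubeIsometry_or_isSigmaMapping_foldPerm π
  · obtain rfl : p = 1 := by grind
    exact .inl (hφ.isCubeIsometry_of_le_one hp (by lia))

end Isometries

theorem mainTheorem3_general (n : ℕ) :
    (n ≡ 1 [MOD 4] →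
      ∀ φ : BoolCube n → BoolCube n, IsWeakIsometry {(n + 1) / 2} φ → φ 0 = 0 →
        ¬ IsCubeIsometry φ → IsSigmaMapping φ) ∧
    (Odd n →
      (∀ φ : BoolCube n → BoolCube n, IsSigmaMapping φ → IsWeakIsometry {(n + 1) / 2} φ) ∧
      (∀ φ : BoolCube n → BoolCube n, IsWeakIsometry {(n + 1) / 2} φ → φ 0 = 0 →
        ¬ IsEvenIsometry φ →
        (∃ (τ : BoolCube n → BoolCube n) (a : BoolCube n),
          IsSigmaMapping τ ∧ a ∈ evenWords n ∧
          ActsAsEvenIsometryOn φ (evenWords n) ∧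
          Set.EqOn φ (cubeTranslation a ∘ τ) (oddWords n)) ∨
        (∃ τ : BoolCube n → BoolCube n,
          IsSigmaMapping τ ∧
          Set.EqOn φ τ (evenWords n) ∧
          ActsAsEvenIsometryOn φ (oddWords n)) ∨
        (∃ (τ₁ τ₂ : BoolCube n → BoolCube n) (a : BoolCube n),
          IsSigmaMapping τ₁ ∧ IsSigmaMapping τ₂ ∧ a ∈ evenWords n ∧
          Set.EqOn φ τ₁ (evenWords n) ∧
          Set.EqOn φ (cubeTranslation a ∘ τ₂) (oddWords n)))) := by
  have hhalf (hn : Odd n) : n + 1 = 2 * ((n + 1) / 2) := by grind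
  refine ⟨fun hn φ hφ hφ0 hφ' => ?_, fun hn => ⟨fun φ hφ => ?_, fun φ hφ hφ0 hφ' => ?_⟩⟩
  · obtain ⟨hn, hp⟩ : Odd n ∧ Odd ((n + 1) / 2) := by
      rw [Nat.ModEq] at hn
      grind
    exact (hφ.isCubeIsometry_or_isSigmaMapping rfl (hhalf hn) hp hφ0).resolve_left hφ'
  · exact hφ.isWeakIsometry (hhalf hn)
  · have hp : 3 ≤ (n + 1) / 2 := by
      by_contra hp
      exact hφ' (hφ.isEvenIsometry_of_le_three rfl (hhalf hn) (by lia))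
    obtain ⟨π, hπ⟩ := hφ.exists_foldPerm_eqOn_evenWords rfl (hhalf hn) hp hφ0
    obtain ⟨ρ, a, ha, hρ⟩ := hφ.exists_foldPerm_eqOn_oddWords rfl (hhalf hn) hp hφ0
    rcases isCubeIsometry_or_isSigmaMapping_foldPerm π with hπ' | hπ' <;>
      rcases isCubeIsometry_or_isSigmaMapping_foldPerm ρ with hρ' | hρ'
    · exact absurd (isEvenIsometry_of_actsAsEvenIsometryOn hφ.1 (hπ'.actsAsEvenIsometryOn hπ)
        ((hρ'.cubeTranslation_comp a).actsAsEvenIsometryOn hρ)) hφ'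
    · exact .inl ⟨_, a, hρ', ha, hπ'.actsAsEvenIsometryOn hπ, hρ⟩
    · exact .inr (.inl ⟨_, hπ', hπ, (hρ'.cubeTranslation_comp a).actsAsEvenIsometryOn hρ⟩)
    · exact .inr (.inr ⟨_, _, a, hπ', hρ', ha, hπ, hρ⟩)

theorem mainTheorem3 (n : ℕ) :
    (n ≡ 1 [MOD 4] →
      (∀ φ : BoolCube n → BoolCube n, IsWeakIsometry {(n + 1) / 2} φ → φ 0 = 0 →
        ¬ IsCubeIsometry φ → IsSigmaMapping φ) ∧
      (∀ φ : BoolCube n → BoolCube n, IsSigmaMapping φ → IsWeakIsometry {(n + 1) / 2} φ)) ∧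
    (n ≡ 3 [MOD 4] →
      ∀ φ : BoolCube n → BoolCube n, IsWeakIsometry {(n + 1) / 2} φ → φ 0 = 0 →
        ¬ IsEvenIsometry φ →
        (∃ (τ : BoolCube n → BoolCube n) (a : BoolCube n),
          IsSigmaMapping τ ∧ a ∈ evenWords n ∧
          ActsAsEvenIsometryOn φ (evenWords n) ∧
          Set.EqOn φ (cubeTranslation a ∘ τ) (oddWords n)) ∨
        (∃ τ : BoolCube n → BoolCube n,
          IsSigmaMapping τ ∧
          Set.EqOn φ τ (evenWords n) ∧
          ActsAsEvenIsometryOn φ (oddWords n)) ∨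
        (∃ (τ₁ τ₂ : BoolCube n → BoolCube n) (a : BoolCube n),
          IsSigmaMapping τ₁ ∧ IsSigmaMapping τ₂ ∧ a ∈ evenWords n ∧
          Set.EqOn φ τ₁ (evenWords n) ∧
          Set.EqOn φ (cubeTranslation a ∘ τ₂) (oddWords n))) := by
  obtain ⟨hone, hodd⟩ := mainTheorem3_general n
  exact ⟨fun h => ⟨hone h, (hodd (Nat.odd_iff.mpr (Nat.odd_of_mod_four_eq_one h))).1⟩,
    fun h => (hodd (Nat.odd_iff.mpr (Nat.odd_of_mod_four_eq_three h))).2⟩
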